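/- Let $n_1,n_2,n_3,r\ge 1$ be integers, $n_{\max}=\max\{n_1,n_2,n_3\}$, and let $\mu\in\mathbb R$. Let $u_1,\dots,u_r\in\mathbb R^{n_1}$, $v_1,\dots,v_r\in\mathbb R^{n_2}$, $w_1,\dots,w_r\in\mathbb R^{n_3}$ be three orthonormal families of $\mu$-incoherent vectors, where $x\in\mathbb R^n$ is $\mu$-incoherent if $x_j^2\le\frac{\mu}{n}\|x\|^2$ for all $j$. On $\mathbb R^{n_1}\otimes\mathbb R^{n_2}\otimes\mathbb R^{n_3}$ let $P^{UV},P^{UW},P^{VW},P^{UVW}$ be the orthogonal projections onto $$\operatorname{span}\{u_i\otimes v_i\otimes z\},\quad \operatorname{span}\{u_i\otimes y\otimes w_i\},\quad \operatorname{span}\{x\otimes v_i\otimes w_i\},\quad \operatorname{span}\{u_i\otimes v_i\otimes w_i\}$$ respectively, where $i$ ranges over $\{1,\dots,r\}$ and $x\in\mathbb R^{n_1},y\in\mathbb R^{n_2},z\in\mathbb R^{n_3}$ are arbitrary. Let $B\in\mathbb R$ and let $A$ be a (fixed) real $n_1\times n_2\times n_3$ tensor that is $(B,r,\mu)$-bounded,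 i.e. $A_{abc}^2\le Br$ for all $a,b,c$; the average of $A_{abc}^2$ over any one of the three indices, the other two being fixed, is at most $B/\mu$; the average over any two indices, the third being fixed, is at most $B/\mu^2$; and the average over all three indices is at most $B/\mu^3$. Let $C\ge1$, $\beta>0$ and $0<m\le n_1n_2n_3$ be real numbers. Let $\Omega\subseteq[n_1]\times[n_2]\times[n_3]$ be a random set that contains each triple independently with probability $m/(n_1n_2n_3)$. Let $R_\Omega$ be the linear operator on tensors that sets the entries outside $\Omega$ to $0$ and multiplies those in $\Omega$ by $n_1n_2n_3/m$, and let $\bar R_\Omega=\mathrm{Id}-R_\Omega$. For a tensor $T$ with slices $T_a=(T_{abc})_{b,c}\in\mathbb R^{n_2\times n_3}$ write $T\otimes T^{\mathsf T}=\sum_{a}T_a\otimes T_a^{\mathsf T}$, a sum of Kronecker products. Let $\|\cdot\|$ denote the spectral norm. **Theorem.** Suppose that 1. $m>10000\,C(2+\beta)^2\,n_{\max}\,r\,\mu^2\ln n_{\max}$, 2. $m>10000\,C(2+\beta)^2\,r\sqrt{n_1}\max\{n_2,n_3\}\,\mu^{3/2}\ln n_{\max}$, 3. $\mu r\le\min\{n_1,n_2,n_3\}$.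 Then for each $P'\in\{P^{UV},P^{UW},P^{VW},P^{UVW}\}$ the matrix $Y=(P'\bar R_\Omega A)\otimes(P'\bar R_\Omega A)^{\mathsf T}$ satisfies $$\Pr\left[\|Y\|>\frac{B\,n_1n_2n_3}{C\,r\,\mu^3}\right]<4\,n_{\max}^{-(\beta+1)}.$$ -/

import Mathlib

open MeasureTheory ProbabilityTheory

noncomputable section

namespace TensorCompletion

/-- Real order-3 tensors of dimensions `n₁ × n₂ × n₃`, with the Euclidean (Frobenius) inner product. -/
abbrev Tensor (n₁ n₂ n₃ : ℕ) : Type := EuclideanSpace ℝ (Fin n₁ × Fin n₂ × Fin n₃)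

/-- A vector `x ∈ ℝⁿ` is `μ`-incoherent if `⟨e_j, x⟩² ≤ (μ / n) ‖x‖²` for every coordinate `j`. -/
def Incoherent {n : ℕ} (μ : ℝ) (x : EuclideanSpace ℝ (Fin n)) : Prop :=
  ∀ j, (x j) ^ 2 ≤ μ / n * ‖x‖ ^ 2

/-- `(B, r, μ)`-bounded tensors: bounds on the squared entries and on their averages over one, two
and three of the indices. -/
structure Bounded {n₁ n₂ n₃ : ℕ} (B : ℝ) (r : ℕ) (μ : ℝ) (A : Tensor n₁ n₂ n₃) : Prop where
  entry : ∀ a b c, A (a, b, c) ^ 2 ≤ B * r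
  avg_a : ∀ b c, (1 / (n₁ : ℝ)) * ∑ a, A (a, b, c) ^ 2 ≤ B / μ
  avg_b : ∀ a c, (1 / (n₂ : ℝ)) * ∑ b, A (a, b, c) ^ 2 ≤ B / μ
  avg_c : ∀ a b, (1 / (n₃ : ℝ)) * ∑ c, A (a, b, c) ^ 2 ≤ B / μ
  avg_ab : ∀ c, (1 / ((n₁ : ℝ) * n₂)) * ∑ a, ∑ b, A (a, b, c) ^ 2 ≤ B / μ ^ 2
  avg_ac : ∀ b, (1 / ((n₁ : ℝ) * n₃)) * ∑ a, ∑ c, A (a, b, c) ^ 2 ≤ B / μ ^ 2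
  avg_bc : ∀ a, (1 / ((n₂ : ℝ) * n₃)) * ∑ b, ∑ c, A (a, b, c) ^ 2 ≤ B / μ ^ 2
  avg_abc : (1 / ((n₁ : ℝ) * n₂ * n₃)) * ∑ a, ∑ b, ∑ c, A (a, b, c) ^ 2 ≤ B / μ ^ 3

/-- The rank-one tensor `x ⊗ y ⊗ z`. -/
def rankOne {n₁ n₂ n₃ : ℕ} (x : EuclideanSpace ℝ (Fin n₁)) (y : EuclideanSpace ℝ (Fin n₂))
    (z : EuclideanSpace ℝ (Fin n₃)) : Tensor n₁ n₂ n₃ :=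
  WithLp.toLp 2 fun t => x t.1 * y t.2.1 * z t.2.2

/-- The linear operator `R_Ω` that sets all entries outside `Ω` to zero and multiplies the entries
in `Ω` by `n₁ n₂ n₃ / m`. -/
def restrict {n₁ n₂ n₃ : ℕ} (m : ℝ) (Ω : Set (Fin n₁ × Fin n₂ × Fin n₃)) :
    Tensor n₁ n₂ n₃ →ₗ[ℝ] Tensor n₁ n₂ n₃ where
  toFun T := WithLp.toLp 2 (Ω.indicator fun t => ((n₁ : ℝ) * n₂ * n₃ / m) * T t)
  map_add' S T := by
    ext t
    by_cases h : t ∈ Ω <;> simp [h, mul_add]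
  map_smul' k T := by
    ext t
    by_cases h : t ∈ Ω <;> simp [h, mul_left_comm]

/-- The operator `Id - R_Ω`. -/
def restrictBar {n₁ n₂ n₃ : ℕ} (m : ℝ) (Ω : Set (Fin n₁ × Fin n₂ × Fin n₃)) :
    Tensor n₁ n₂ n₃ →ₗ[ℝ] Tensor n₁ n₂ n₃ :=
  LinearMap.id - restrict m Ω

section Projections

variable {n₁ n₂ n₃ r : ℕ}

/-- Orthogonal projection onto the span of the tensors `u_i ⊗ v_i ⊗ z`, `z` arbitrary. -/
def projUV (n₃ : ℕ) (u : Fin r → EuclideanSpace ℝ (Fin n₁)) (v : Fin r → EuclideanSpace ℝ (Fin n₂)) :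
    Tensor n₁ n₂ n₃ →L[ℝ] Tensor n₁ n₂ n₃ :=
  (Submodule.span ℝ {T : Tensor n₁ n₂ n₃ | ∃ i z, T = rankOne (u i) (v i) z}).starProjection

/-- Orthogonal projection onto the span of the tensors `u_i ⊗ y ⊗ w_i`, `y` arbitrary. -/
def projUW (n₂ : ℕ) (u : Fin r → EuclideanSpace ℝ (Fin n₁)) (w : Fin r → EuclideanSpace ℝ (Fin n₃)) :
    Tensor n₁ n₂ n₃ →L[ℝ] Tensor n₁ n₂ n₃ :=
  (Submodule.span ℝ {T : Tensor n₁ n₂ n₃ | ∃ i y, T = rankOne (u i) y (w i)}).starProjection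

/-- Orthogonal projection onto the span of the tensors `x ⊗ v_i ⊗ w_i`, `x` arbitrary. -/
def projVW (n₁ : ℕ) (v : Fin r → EuclideanSpace ℝ (Fin n₂)) (w : Fin r → EuclideanSpace ℝ (Fin n₃)) :
    Tensor n₁ n₂ n₃ →L[ℝ] Tensor n₁ n₂ n₃ :=
  (Submodule.span ℝ {T : Tensor n₁ n₂ n₃ | ∃ i x, T = rankOne x (v i) (w i)}).starProjection

/-- Orthogonal projection onto the span of the tensors `u_i ⊗ v_i ⊗ w_i`. -/
def projUVW (u : Fin r → EuclideanSpace ℝ (Fin n₁)) (v : Fin r → EuclideanSpace ℝ (Fin n₂))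
    (w : Fin r → EuclideanSpace ℝ (Fin n₃)) : Tensor n₁ n₂ n₃ →L[ℝ] Tensor n₁ n₂ n₃ :=
  (Submodule.span ℝ {T : Tensor n₁ n₂ n₃ | ∃ i, T = rankOne (u i) (v i) (w i)}).starProjection

end Projections

/-- The slice `T_a`, the `n₂ × n₃` matrix with entries `(b, c) ↦ T_{abc}`. -/
def slice {n₁ n₂ n₃ : ℕ} (T : Tensor n₁ n₂ n₃) (a : Fin n₁) : Matrix (Fin n₂) (Fin n₃) ℝ :=
  Matrix.of fun b c => T (a, b, c)

/-- The matrix `T ⊗ Tᵀ = ∑ₐ T_a ⊗ (T_a)ᵀ` (Kronecker products of slices). -/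
def tensorTranspose {n₁ n₂ n₃ : ℕ} (T : Tensor n₁ n₂ n₃) :
    Matrix (Fin n₂ × Fin n₃) (Fin n₃ × Fin n₂) ℝ :=
  ∑ a, Matrix.kronecker (slice T a) (slice T a).transpose

/-- The spectral norm of a matrix: its operator norm between Euclidean spaces. -/
def specNorm {I J : Type*} [Fintype I] [Fintype J] [DecidableEq J] (M : Matrix I J ℝ) : ℝ :=
  ‖LinearMap.toContinuousLinearMap (Matrix.toEuclideanLin M)‖

end TensorCompletion

end

/-!
Each projection has an explicit form: for orthonormal `u`, `v`, the projection of `T` onto the span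
of the `u i ⊗ v i ⊗ z` is `∑ i, u i ⊗ v i ⊗ T(u i, v i, ·)`, and similarly in the other three cases
(`projUV_apply`, `projUW_apply`, `projVW_apply`, `projUVW_apply`). For tensors of this shape
`T ⊗ Tᵀ` is a sum of rank-one matrices with mutually orthogonal row vectors and mutually orthogonal
column vectors, so its spectral norm is at most the largest squared norm of a contraction
(`specNorm_tensorTranspose_le_of_orthonormal_fst`,
`specNorm_tensorTranspose_le_of_orthonormal_snd_trd`). No matrix concentration is needed: it is
enough to bound, for each `i`, the norm of one random vector such as `T(u i, v i, ·)` with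
`T` the centred sample of `A`.

That vector is a sum of independent centred vectors. A dimension-free Bernstein-type bound
(`setBernoulli_norm_sum_ge_le`) follows by induction on the index set from the one-step estimate
`expPotential_bernoulli_step` for the potential `exp (√(L² + ‖s‖²) / (2L))`: a centred step `X` with
`‖X‖ ≤ L` multiplies its expectation by at most `1 + 𝔼‖X‖² / L²`. With `K = 10000 (2 + β)² log nmax`
and `τ = B n₁ n₂ n₃ / (C r μ³)`, the average of all the squared entries of `A` bounds the total
variance by `τ / K`, and the entrywise bound on `A` bounds each step by `4 √τ / K`
(`setBernoulli_contraction_gt_le`). The failure probability of one contraction is thus at most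
`exp (1/2 - K / 16)`, and a union bound over the `r ≤ nmax` contractions finishes the proof.
-/

namespace TensorCompletion

/-! ### A tail bound for sums of independent centred Bernoulli multiples of vectors -/

section Tail

variable {E : Type*} [NormedAddCommGroup E] [InnerProductSpace ℝ E]

/-- A smooth, strictly positive substitute for `s ↦ exp (‖s‖ / (2 * L))`. -/
noncomputable def expPotential (L : ℝ) (s : E) : ℝ := Real.exp (√(L ^ 2 + ‖s‖ ^ 2) / (2 * L))

/-- A step `x` of norm at most `L` changes the potential by a term linear in `x`, which averages out
over centred steps, and a relative error of at most `‖x‖ ^ 2 / L ^ 2`. -/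
lemma expPotential_add_le {L : ℝ} (hL : 0 < L) (s x : E) (hx : ‖x‖ ≤ L) :
    expPotential L (s + x) ≤ expPotential L s *
      (1 + inner ℝ s x / (2 * L * √(L ^ 2 + ‖s‖ ^ 2)) + ‖x‖ ^ 2 / L ^ 2) := by
  unfold expPotential
  set w := √(L ^ 2 + ‖s‖ ^ 2) with hw
  have hw2 : w ^ 2 = L ^ 2 + ‖s‖ ^ 2 := Real.sq_sqrt (by positivity)
  have hw0 : 0 < w := Real.sqrt_pos.2 (by positivity)
  have hLw : L ≤ w := abs_le_of_sq_le_sq' (by nlinarith [sq_nonneg ‖s‖]) hw0.le |>.2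
  have hsw : ‖s‖ ≤ w := abs_le_of_sq_le_sq' (by nlinarith) hw0.le |>.2
  have hin : |inner ℝ s x| ≤ w * ‖x‖ :=
    (abs_real_inner_le_norm s x).trans (by gcongr)
  set e := (2 * inner ℝ s x + ‖x‖ ^ 2) / (4 * L * w) with he
  -- concavity of the square root
  have hd : √(L ^ 2 + ‖s + x‖ ^ 2) / (2 * L) ≤ w / (2 * L) + e := by
    have h1 : √(L ^ 2 + ‖s + x‖ ^ 2) ≤ w + (2 * inner ℝ s x + ‖x‖ ^ 2) / (2 * w) := by
      have h3 : (w + (2 * inner ℝ s x + ‖x‖ ^ 2) / (2 * w)) ^ 2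
          = w ^ 2 + (2 * inner ℝ s x + ‖x‖ ^ 2)
            + ((2 * inner ℝ s x + ‖x‖ ^ 2) / (2 * w)) ^ 2 := by
        field_simp; ring
      apply Real.sqrt_le_iff.2 ⟨?_, ?_⟩
      · have : w + (2 * inner ℝ s x + ‖x‖ ^ 2) / (2 * w)
            = (w ^ 2 + (w ^ 2 + 2 * inner ℝ s x + ‖x‖ ^ 2)) / (2 * w) := by
          field_simp; ring
        rw [this]
        have h4 := norm_add_sq_real s x
        have : 0 ≤ w ^ 2 + 2 * inner ℝ s x + ‖x‖ ^ 2 := by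
          nlinarith [sq_nonneg ‖s + x‖, sq_nonneg L]
        positivity
      · rw [h3, norm_add_sq_real, hw2]
        nlinarith [sq_nonneg ((2 * inner ℝ s x + ‖x‖ ^ 2) / (2 * w))]
    calc _ ≤ (w + (2 * inner ℝ s x + ‖x‖ ^ 2) / (2 * w)) / (2 * L) := by gcongr
      _ = _ := by rw [he]; field_simp; ring
  have hxw : ‖x‖ ^ 2 ≤ w * ‖x‖ := by nlinarith [norm_nonneg x]
  have he' : |e| ≤ 3 / 4 * (‖x‖ / L) := by
    rw [he, abs_div, abs_of_pos (show 0 < 4 * L * w by positivity), div_le_iff₀ (by positivity)]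
    have : 3 / 4 * (‖x‖ / L) * (4 * L * w) = 3 * (w * ‖x‖) := by field_simp
    rw [this, abs_le]
    have := abs_le.1 hin
    constructor <;> nlinarith [sq_nonneg ‖x‖]
  have hxL : ‖x‖ / L ≤ 1 := (div_le_one hL).2 hx
  have hexp : Real.exp e ≤ 1 + e + e ^ 2 := by
    have := abs_le.1 (Real.abs_exp_sub_one_sub_id_le (x := e) (by linarith))
    linarith [this.2]
  have hesq : e ^ 2 ≤ 9 / 16 * (‖x‖ ^ 2 / L ^ 2) := by
    rw [← sq_abs e]
    calc |e| ^ 2 ≤ (3 / 4 * (‖x‖ / L)) ^ 2 := by gcongr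
      _ = _ := by ring
  have hel : e ≤ inner ℝ s x / (2 * L * w) + 1 / 4 * (‖x‖ ^ 2 / L ^ 2) := by
    have h1 : e = inner ℝ s x / (2 * L * w) + ‖x‖ ^ 2 / (4 * L * w) := by
      rw [he]; field_simp; ring
    have h2 : ‖x‖ ^ 2 / (4 * L * w) ≤ ‖x‖ ^ 2 / (4 * L * L) := by gcongr
    have h3 : ‖x‖ ^ 2 / (4 * L * L) = 1 / 4 * (‖x‖ ^ 2 / L ^ 2) := by field_simp
    linarith
  calc _ ≤ Real.exp (w / (2 * L) + e) := Real.exp_le_exp.2 hd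
    _ = Real.exp (w / (2 * L)) * Real.exp e := Real.exp_add _ _
    _ ≤ _ := by
      gcongr
      have : 0 ≤ ‖x‖ ^ 2 / L ^ 2 := by positivity
      linarith

/-- The average of the potential over one step `(1 - ξ / p) • x`, where `ξ` is Bernoulli with
parameter `p`: the linear term of `expPotential_add_le` cancels. -/
lemma expPotential_bernoulli_step {L p : ℝ} (hL : 0 < L) (hp0 : 0 < p) (hp1 : p ≤ 1) (s x : E)
    (hx : ‖x‖ / p ≤ L) :
    p * expPotential L (s + (1 - 1 / p) • x) + (1 - p) * expPotential L (s + x) ≤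
      expPotential L s * Real.exp (‖x‖ ^ 2 / (p * L ^ 2)) := by
  have hx1 : ‖x‖ ≤ L := (le_div_self (norm_nonneg x) hp0 hp1).trans hx
  have hinv : 1 ≤ 1 / p := (one_le_div hp0).2 hp1
  have hx2 : ‖(1 - 1 / p) • x‖ ≤ L := by
    rw [norm_smul, Real.norm_eq_abs, abs_of_nonpos (by linarith)]
    refine le_trans ?_ hx
    calc -(1 - 1 / p) * ‖x‖ ≤ 1 / p * ‖x‖ := by gcongr; linarith
      _ = ‖x‖ / p := by ring
  have h1 := expPotential_add_le hL s _ hx1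
  have h2 := expPotential_add_le hL s _ hx2
  have hφ : 0 < expPotential L s := Real.exp_pos _
  rw [inner_smul_right, norm_smul, mul_pow, Real.norm_eq_abs, sq_abs] at h2
  set q := inner ℝ s x
  set w := √(L ^ 2 + ‖s‖ ^ 2)
  have hw0 : 0 < w := Real.sqrt_pos.2 (by positivity)
  calc _ ≤ p * (expPotential L s * (1 + (1 - 1 / p) * q / (2 * L * w)
          + (1 - 1 / p) ^ 2 * ‖x‖ ^ 2 / L ^ 2))
        + (1 - p) * (expPotential L s * (1 + q / (2 * L * w) + ‖x‖ ^ 2 / L ^ 2)) := by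
        have : 0 ≤ 1 - p := by linarith
        gcongr
    _ = expPotential L s * (1 + (‖x‖ ^ 2 / (p * L ^ 2) - ‖x‖ ^ 2 / L ^ 2)) := by
        field_simp; ring
    _ ≤ expPotential L s * (‖x‖ ^ 2 / (p * L ^ 2) + 1) := by
        have : 0 ≤ ‖x‖ ^ 2 / L ^ 2 := by positivity
        exact mul_le_mul_of_nonneg_left (by linarith) hφ.le
    _ ≤ _ := by
        gcongr
        exact Real.add_one_le_exp _

variable {ι : Type*}

/-- The expected potential of a sum of independent centred Bernoulli steps, with the expectation
written as a sum over the subsets of the index set. -/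
lemma sum_powerset_expPotential_le [DecidableEq ι] {L p : ℝ} (hL : 0 < L) (hp0 : 0 < p)
    (hp1 : p ≤ 1) (x : ι → E) (hx : ∀ t, ‖x t‖ / p ≤ L) (s : Finset ι) (v : E) :
    ∑ Ω ∈ s.powerset, (∏ t ∈ s, if t ∈ Ω then p else 1 - p) *
        expPotential L (v + ∑ t ∈ s, (1 - if t ∈ Ω then 1 / p else 0) • x t) ≤
      expPotential L v * Real.exp (∑ t ∈ s, ‖x t‖ ^ 2 / (p * L ^ 2)) := by
  induction s using Finset.induction_on generalizing v with
  | empty => simp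
  | insert a s ha ih =>
    rw [Finset.sum_powerset_insert ha, Finset.sum_insert ha, Real.exp_add]
    have hne : ∀ t ∈ s, t ≠ a := fun t ht h => ha (h ▸ ht)
    have e1 : ∀ Ω ∈ s.powerset,
        (∏ t ∈ insert a s, if t ∈ Ω then p else 1 - p) *
          expPotential L (v + ∑ t ∈ insert a s, (1 - if t ∈ Ω then 1 / p else 0) • x t)
        = (1 - p) * ((∏ t ∈ s, if t ∈ Ω then p else 1 - p) *
          expPotential L ((v + x a) + ∑ t ∈ s, (1 - if t ∈ Ω then 1 / p else 0) • x t)) := by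
      intro Ω hΩ
      have haΩ : a ∉ Ω := fun h => ha (Finset.mem_powerset.1 hΩ h)
      rw [Finset.prod_insert ha, Finset.sum_insert ha, if_neg haΩ, if_neg haΩ, sub_zero, one_smul,
        add_assoc v, mul_assoc]
    have e2 : ∀ Ω ∈ s.powerset,
        (∏ t ∈ insert a s, if t ∈ insert a Ω then p else 1 - p) *
          expPotential L (v + ∑ t ∈ insert a s, (1 - if t ∈ insert a Ω then 1 / p else 0) • x t)
        = p * ((∏ t ∈ s, if t ∈ Ω then p else 1 - p) *
          expPotential L ((v + (1 - 1 / p) • x a)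
            + ∑ t ∈ s, (1 - if t ∈ Ω then 1 / p else 0) • x t)) := by
      intro Ω hΩ
      rw [Finset.prod_insert ha, Finset.sum_insert ha, if_pos (Finset.mem_insert_self a Ω),
        if_pos (Finset.mem_insert_self a Ω), add_assoc v, mul_assoc]
      congr 2
      · refine Finset.prod_congr rfl fun t ht => ?_
        simp [hne t ht]
      · congr 2
        congr 1
        refine Finset.sum_congr rfl fun t ht => ?_
        simp [hne t ht]
    rw [Finset.sum_congr rfl e1, Finset.sum_congr rfl e2, ← Finset.mul_sum, ← Finset.mul_sum]
    set T := Real.exp (∑ t ∈ s, ‖x t‖ ^ 2 / (p * L ^ 2))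
    have hp1' : 0 ≤ 1 - p := by linarith
    calc _ ≤ (1 - p) * (expPotential L (v + x a) * T)
          + p * (expPotential L (v + (1 - 1 / p) • x a) * T) := by
          gcongr <;> apply ih
      _ = (p * expPotential L (v + (1 - 1 / p) • x a) + (1 - p) * expPotential L (v + x a)) * T := by
          ring
      _ ≤ (expPotential L v * Real.exp (‖x a‖ ^ 2 / (p * L ^ 2))) * T := by
          gcongr
          exact expPotential_bernoulli_step hL hp0 hp1 v _ (hx a)
      _ = _ := by ring

/-- A Bernstein-type tail bound in a Hilbert space, free of any dependence on the dimension. -/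
theorem setBernoulli_norm_sum_ge_le [Fintype ι] {L : ℝ} {p : unitInterval} (hL : 0 < L)
    (hp0 : 0 < (p : ℝ)) (x : ι → E) (hx : ∀ t, ‖x t‖ / p ≤ L) (τ : ℝ) :
    setBernoulli (Set.univ : Set ι) p
        {Ω | τ ≤ ‖∑ t, (1 - Ω.indicator (fun _ => 1 / (p : ℝ)) t) • x t‖} ≤
      ENNReal.ofReal
        (Real.exp (1 / 2 + (∑ t, ‖x t‖ ^ 2) / (p * L ^ 2) - τ / (2 * L))) := by
  classical
  set P := setBernoulli (Set.univ : Set ι) p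
  set z : Set ι → E := fun Ω => ∑ t, (1 - Ω.indicator (fun _ => 1 / (p : ℝ)) t) • x t
  have hint : ∫ Ω, expPotential L (z Ω) ∂P ≤
      Real.exp (1 / 2 + (∑ t, ‖x t‖ ^ 2) / (p * L ^ 2)) := by
    rw [integral_fintype (Integrable.of_finite)]
    rw [← (Fintype.finsetEquivSet (α := ι)).sum_comp]
    have key := sum_powerset_expPotential_le hL hp0 p.2.2 x hx Finset.univ 0
    have h0 : expPotential L (0 : E) = Real.exp (1 / 2) := by
      unfold expPotential
      rw [norm_zero]
      congr 1
      rw [show L ^ 2 + (0 : ℝ) ^ 2 = L ^ 2 by ring, Real.sqrt_sq hL.le]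
      field_simp
    rw [h0, ← Real.exp_add, ← Finset.sum_div, Finset.powerset_univ] at key
    refine le_of_eq_of_le (Finset.sum_congr rfl fun Ω _ => ?_) key
    simp only [zero_add, smul_eq_mul, P, z]
    congr 1
    · rw [Fintype.finsetEquivSet_apply,
        setBernoulli_real_singleton p (Set.subset_univ _) Set.finite_univ, Finset.prod_ite,
        Finset.prod_const, Finset.prod_const, Set.ncard_coe_finset, ← Set.compl_eq_univ_sdiff,
        ← Finset.coe_compl, Set.ncard_coe_finset]
      congr 3
      · ext; simp
      · ext; simp
    · simp [Set.indicator_apply]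
  have hmarkov := mul_meas_ge_le_integral_of_nonneg (μ := P) (f := fun Ω => expPotential L (z Ω))
    (Filter.Eventually.of_forall fun _ => (Real.exp_pos _).le) Integrable.of_finite
    (Real.exp (τ / (2 * L)))
  have hsub : {Ω | τ ≤ ‖z Ω‖} ⊆ {Ω | Real.exp (τ / (2 * L)) ≤ expPotential L (z Ω)} := by
    intro Ω hΩ
    refine Real.exp_le_exp.2 ?_
    have hΩ' : τ ≤ ‖z Ω‖ := hΩ
    gcongr
    exact hΩ'.trans (Real.le_sqrt_of_sq_le (by nlinarith [sq_nonneg L]))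
  refine (measure_mono hsub).trans ?_
  rw [← ofReal_measureReal]
  refine ENNReal.ofReal_le_ofReal ?_
  rw [Real.exp_sub, le_div_iff₀ (Real.exp_pos _), mul_comm]
  exact hmarkov.trans hint

end Tail

/-! ### Spectral norms of sums of mutually orthogonal rank-one matrices -/

section SpectralNorm

lemma norm_sq_sum_smul_le_of_pairwise_inner_eq_zero {E K : Type*} [NormedAddCommGroup E]
    [InnerProductSpace ℝ E] [Fintype K] (P : K → E)
    (hP : Pairwise fun k l => inner ℝ (P k) (P l) = 0) {a : ℝ} (ha : ∀ k, ‖P k‖ ≤ a) (c : K → ℝ) :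
    ‖∑ k, c k • P k‖ ^ 2 ≤ a ^ 2 * ∑ k, c k ^ 2 := by
  rw [← real_inner_self_eq_norm_sq, sum_inner, Finset.mul_sum]
  refine Finset.sum_le_sum fun k _ => ?_
  rw [inner_sum, Finset.sum_eq_single k]
  · rw [inner_smul_left, inner_smul_right, real_inner_self_eq_norm_sq, RCLike.conj_to_real]
    have : ‖P k‖ ^ 2 ≤ a ^ 2 := by gcongr; exact ha k
    nlinarith [mul_le_mul_of_nonneg_left this (sq_nonneg (c k))]
  · intro l _ hl
    rw [inner_smul_left, inner_smul_right, hP hl.symm]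
    simp
  · simp

/-- Bessel's inequality for orthogonal, not necessarily normalised, families. -/
lemma sum_inner_sq_le_of_pairwise_inner_eq_zero {E K : Type*} [NormedAddCommGroup E]
    [InnerProductSpace ℝ E] [Fintype K] (Q : K → E)
    (hQ : Pairwise fun k l => inner ℝ (Q k) (Q l) = 0) {b : ℝ} (hb : ∀ k, ‖Q k‖ ≤ b) (x : E) :
    ∑ k, inner ℝ (Q k) x ^ 2 ≤ b ^ 2 * ‖x‖ ^ 2 := by
  set S := ∑ k, inner ℝ (Q k) x ^ 2 with hS
  have hS0 : 0 ≤ S := Finset.sum_nonneg fun k _ => sq_nonneg _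
  have h1 := norm_sq_sum_smul_le_of_pairwise_inner_eq_zero Q hQ hb fun k => inner ℝ (Q k) x
  have h2 : S ≤ ‖∑ k, inner ℝ (Q k) x • Q k‖ * ‖x‖ := by
    refine le_trans (le_of_eq ?_) (real_inner_le_norm _ _)
    rw [sum_inner, hS]
    exact Finset.sum_congr rfl fun k _ => by rw [inner_smul_left, RCLike.conj_to_real, sq]
  rcases hS0.eq_or_lt with h | h
  · rw [← h]; positivity
  · refine le_of_mul_le_mul_right ?_ h
    calc S * S ≤ (‖∑ k, inner ℝ (Q k) x • Q k‖ * ‖x‖) ^ 2 := by nlinarith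
      _ = ‖∑ k, inner ℝ (Q k) x • Q k‖ ^ 2 * ‖x‖ ^ 2 := by ring
      _ ≤ b ^ 2 * S * ‖x‖ ^ 2 := by gcongr
      _ = _ := by ring

lemma specNorm_sum_mul_le {I J K : Type*} [Fintype I] [Fintype J] [DecidableEq J] [Fintype K]
    (P : K → EuclideanSpace ℝ I) (Q : K → EuclideanSpace ℝ J)
    (hP : Pairwise fun k l => inner ℝ (P k) (P l) = 0)
    (hQ : Pairwise fun k l => inner ℝ (Q k) (Q l) = 0) {a b : ℝ} (ha0 : 0 ≤ a) (hb0 : 0 ≤ b)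
    (ha : ∀ k, ‖P k‖ ≤ a) (hb : ∀ k, ‖Q k‖ ≤ b) :
    specNorm (Matrix.of fun i j => ∑ k, P k i * Q k j) ≤ a * b := by
  refine ContinuousLinearMap.opNorm_le_bound _ (by positivity) fun x => ?_
  have hx : Matrix.toEuclideanLin (Matrix.of fun i j => ∑ k, P k i * Q k j) x
      = ∑ k, inner ℝ (Q k) x • P k := by
    ext i
    simp only [Matrix.toLpLin_apply, Matrix.mulVec, dotProduct, Matrix.of_apply, WithLp.ofLp_sum,
      WithLp.ofLp_smul, Finset.sum_apply, Pi.smul_apply, smul_eq_mul, PiLp.inner_apply,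
      RCLike.inner_apply, conj_trivial, Finset.sum_mul]
    rw [Finset.sum_comm]
    exact Finset.sum_congr rfl fun k _ => Finset.sum_congr rfl fun j _ => by ring
  rw [LinearMap.coe_toContinuousLinearMap', hx]
  refine abs_le_of_sq_le_sq' ?_ (by positivity) |>.2
  calc _ ≤ a ^ 2 * ∑ k, inner ℝ (Q k) x ^ 2 :=
        norm_sq_sum_smul_le_of_pairwise_inner_eq_zero P hP ha _
    _ ≤ a ^ 2 * (b ^ 2 * ‖x‖ ^ 2) := by
        gcongr
        exact sum_inner_sq_le_of_pairwise_inner_eq_zero Q hQ hb x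
    _ = _ := by ring

/-- The Kronecker product `x ⊗ y` of two vectors. -/
def vecTensor {I J : Type*} (x : EuclideanSpace ℝ I) (y : EuclideanSpace ℝ J) :
    EuclideanSpace ℝ (I × J) :=
  WithLp.toLp 2 fun t => x t.1 * y t.2

lemma inner_vecTensor {I J : Type*} [Fintype I] [Fintype J] (x x' : EuclideanSpace ℝ I)
    (y y' : EuclideanSpace ℝ J) :
    inner ℝ (vecTensor x y) (vecTensor x' y') = inner ℝ x x' * inner ℝ y y' := by
  simp only [vecTensor, PiLp.inner_apply, RCLike.inner_apply, conj_trivial, Fintype.sum_prod_type,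
    Finset.sum_mul_sum]
  exact Finset.sum_congr rfl fun i _ => Finset.sum_congr rfl fun j _ => by ring

lemma norm_vecTensor {I J : Type*} [Fintype I] [Fintype J] (x : EuclideanSpace ℝ I)
    (y : EuclideanSpace ℝ J) : ‖vecTensor x y‖ = ‖x‖ * ‖y‖ := by
  rw [← sq_eq_sq₀ (norm_nonneg _) (by positivity), ← real_inner_self_eq_norm_sq, inner_vecTensor,
    real_inner_self_eq_norm_sq, real_inner_self_eq_norm_sq]
  ring

variable {n₁ n₂ n₃ r : ℕ}

lemma tensorTranspose_sum_rankOne (x : Fin r → EuclideanSpace ℝ (Fin n₁))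
    (y : Fin r → EuclideanSpace ℝ (Fin n₂)) (z : Fin r → EuclideanSpace ℝ (Fin n₃)) :
    tensorTranspose (∑ k, rankOne (x k) (y k) (z k)) =
      Matrix.of fun s t => ∑ kl : Fin r × Fin r,
        (inner ℝ (x kl.1) (x kl.2) • vecTensor (y kl.1) (z kl.2)) s *
          vecTensor (z kl.1) (y kl.2) t := by
  ext ⟨b, c⟩ ⟨c', b'⟩
  simp only [tensorTranspose, slice, rankOne, vecTensor, Matrix.sum_apply, Matrix.kronecker,
    Matrix.kroneckerMap_apply, Matrix.of_apply, Matrix.transpose_apply, WithLp.ofLp_sum,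
    Finset.sum_apply, WithLp.ofLp_smul, Pi.smul_apply, smul_eq_mul, PiLp.inner_apply,
    RCLike.inner_apply, conj_trivial, Finset.sum_mul_sum, Fintype.sum_prod_type]
  rw [Finset.sum_comm]
  refine Finset.sum_congr rfl fun k _ => ?_
  rw [Finset.sum_comm]
  refine Finset.sum_congr rfl fun l _ => ?_
  rw [Finset.sum_mul, Finset.sum_mul]
  exact Finset.sum_congr rfl fun a _ => by ring

/-- If the first factors are orthonormal, only the diagonal terms of `T ⊗ Tᵀ` survive. -/
lemma specNorm_tensorTranspose_le_of_orthonormal_fst {x : Fin r → EuclideanSpace ℝ (Fin n₁)}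
    (hx : Orthonormal ℝ x) (y : Fin r → EuclideanSpace ℝ (Fin n₂))
    (z : Fin r → EuclideanSpace ℝ (Fin n₃))
    (hyz : Pairwise fun k l => inner ℝ (y k) (y l) * inner ℝ (z k) (z l) = 0)
    {M : ℝ} (hM0 : 0 ≤ M) (hM : ∀ k, (‖y k‖ * ‖z k‖) ^ 2 ≤ M) :
    specNorm (tensorTranspose (∑ k, rankOne (x k) (y k) (z k))) ≤ M := by
  have h : tensorTranspose (∑ k, rankOne (x k) (y k) (z k)) =
      Matrix.of fun s t => ∑ k, vecTensor (y k) (z k) s * vecTensor (z k) (y k) t := by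
    rw [tensorTranspose_sum_rankOne]
    ext s t
    rw [Matrix.of_apply, Matrix.of_apply, Fintype.sum_prod_type]
    refine Finset.sum_congr rfl fun k _ => ?_
    rw [Finset.sum_eq_single k]
    · simp [hx.1 k]
    · intro l _ hl
      simp [hx.2 hl.symm]
    · simp
  rw [h, ← Real.mul_self_sqrt hM0]
  have hle : ∀ k, ‖y k‖ * ‖z k‖ ≤ √M := fun k => Real.le_sqrt_of_sq_le (hM k)
  refine specNorm_sum_mul_le _ _ (fun k l hkl => ?_) (fun k l hkl => ?_) (Real.sqrt_nonneg M)
    (Real.sqrt_nonneg M) (fun k => ?_) (fun k => ?_)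
  · exact (inner_vecTensor _ _ _ _).trans (hyz hkl)
  · exact (inner_vecTensor _ _ _ _).trans ((mul_comm _ _).trans (hyz hkl))
  · rw [norm_vecTensor]; exact hle k
  · rw [norm_vecTensor, mul_comm]; exact hle k

/-- Here the rank-one summands are `⟪x k, x l⟫ (y k ⊗ z l) (z k ⊗ y l)ᵀ`, indexed by all pairs
`(k, l)`; their vectors are orthonormal, and the coefficients are bounded by Cauchy–Schwarz. -/
lemma specNorm_tensorTranspose_le_of_orthonormal_snd_trd
    (x : Fin r → EuclideanSpace ℝ (Fin n₁)) {y : Fin r → EuclideanSpace ℝ (Fin n₂)}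
    {z : Fin r → EuclideanSpace ℝ (Fin n₃)} (hy : Orthonormal ℝ y) (hz : Orthonormal ℝ z)
    {M : ℝ} (hM0 : 0 ≤ M) (hM : ∀ k, ‖x k‖ ^ 2 ≤ M) :
    specNorm (tensorTranspose (∑ k, rankOne (x k) (y k) (z k))) ≤ M := by
  rw [tensorTranspose_sum_rankOne, ← mul_one M]
  have hyz : ∀ k l : Fin r × Fin r, k ≠ l →
      inner ℝ (y k.1) (y l.1) * inner ℝ (z k.2) (z l.2) = 0 := by
    rintro ⟨k, k'⟩ ⟨l, l'⟩ hkl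
    by_cases h : k = l
    · have : k' ≠ l' := by rintro rfl; exact hkl (by rw [h])
      simp [hz.2 this]
    · simp [hy.2 h]
  have hzy : ∀ k l : Fin r × Fin r, k ≠ l →
      inner ℝ (z k.1) (z l.1) * inner ℝ (y k.2) (y l.2) = 0 := by
    intro k l hkl
    rw [mul_comm]
    exact hyz k.swap l.swap (Prod.swap_injective.ne hkl)
  have hle : ∀ k, ‖x k‖ ≤ √M := fun k => Real.le_sqrt_of_sq_le (hM k)
  refine specNorm_sum_mul_le _ _ (fun k l hkl => ?_) (fun k l hkl => ?_) hM0 zero_le_one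
    (fun k => ?_) (fun k => ?_)
  · simp [inner_smul_left, inner_smul_right, inner_vecTensor, hyz k l hkl]
  · exact (inner_vecTensor _ _ _ _).trans (hzy k l hkl)
  · rw [norm_smul, norm_vecTensor, hy.1, hz.1, mul_one, mul_one, ← Real.mul_self_sqrt hM0]
    exact (abs_real_inner_le_norm _ _).trans
      (mul_le_mul (hle _) (hle _) (norm_nonneg _) (Real.sqrt_nonneg _))
  · rw [norm_vecTensor, hy.1, hz.1, mul_one]

end SpectralNorm

/-! ### Contractions and the projections -/

section Contractions

variable {n₁ n₂ n₃ r : ℕ}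

/-- The contraction `T(·, y, z)` of the last two indices. -/
def contractBC (T : Tensor n₁ n₂ n₃) (y : EuclideanSpace ℝ (Fin n₂))
    (z : EuclideanSpace ℝ (Fin n₃)) : EuclideanSpace ℝ (Fin n₁) :=
  WithLp.toLp 2 fun a => ∑ b, ∑ c, T (a, b, c) * (y b * z c)

/-- The contraction `T(x, ·, z)` of the outer two indices. -/
def contractAC (T : Tensor n₁ n₂ n₃) (x : EuclideanSpace ℝ (Fin n₁))
    (z : EuclideanSpace ℝ (Fin n₃)) : EuclideanSpace ℝ (Fin n₂) :=
  WithLp.toLp 2 fun b => ∑ a, ∑ c, T (a, b, c) * (x a * z c)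

/-- The contraction `T(x, y, ·)` of the first two indices. -/
def contractAB (T : Tensor n₁ n₂ n₃) (x : EuclideanSpace ℝ (Fin n₁))
    (y : EuclideanSpace ℝ (Fin n₂)) : EuclideanSpace ℝ (Fin n₃) :=
  WithLp.toLp 2 fun c => ∑ a, ∑ b, T (a, b, c) * (x a * y b)

lemma inner_rankOne_eq_contractBC (T : Tensor n₁ n₂ n₃) (x : EuclideanSpace ℝ (Fin n₁))
    (y : EuclideanSpace ℝ (Fin n₂)) (z : EuclideanSpace ℝ (Fin n₃)) :
    inner ℝ T (rankOne x y z) = inner ℝ (contractBC T y z) x := by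
  simp only [rankOne, contractBC, PiLp.inner_apply, RCLike.inner_apply, conj_trivial,
    Fintype.sum_prod_type, Finset.mul_sum]
  exact Finset.sum_congr rfl fun a _ => Finset.sum_congr rfl fun b _ =>
    Finset.sum_congr rfl fun c _ => by ring

lemma inner_rankOne_eq_contractAC (T : Tensor n₁ n₂ n₃) (x : EuclideanSpace ℝ (Fin n₁))
    (y : EuclideanSpace ℝ (Fin n₂)) (z : EuclideanSpace ℝ (Fin n₃)) :
    inner ℝ T (rankOne x y z) = inner ℝ (contractAC T x z) y := by
  simp only [rankOne, contractAC, PiLp.inner_apply, RCLike.inner_apply, conj_trivial,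
    Fintype.sum_prod_type, Finset.mul_sum]
  rw [Finset.sum_comm]
  exact Finset.sum_congr rfl fun b _ => Finset.sum_congr rfl fun a _ =>
    Finset.sum_congr rfl fun c _ => by ring

lemma inner_rankOne_eq_contractAB (T : Tensor n₁ n₂ n₃) (x : EuclideanSpace ℝ (Fin n₁))
    (y : EuclideanSpace ℝ (Fin n₂)) (z : EuclideanSpace ℝ (Fin n₃)) :
    inner ℝ T (rankOne x y z) = inner ℝ (contractAB T x y) z := by
  simp only [rankOne, contractAB, PiLp.inner_apply, RCLike.inner_apply, conj_trivial,
    Fintype.sum_prod_type, Finset.mul_sum]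
  simp_rw [Finset.sum_comm (s := (Finset.univ : Finset (Fin n₂)))
    (t := (Finset.univ : Finset (Fin n₃)))]
  rw [Finset.sum_comm]
  exact Finset.sum_congr rfl fun c _ => Finset.sum_congr rfl fun a _ =>
    Finset.sum_congr rfl fun b _ => by ring

lemma inner_rankOne_rankOne (x x' : EuclideanSpace ℝ (Fin n₁)) (y y' : EuclideanSpace ℝ (Fin n₂))
    (z z' : EuclideanSpace ℝ (Fin n₃)) :
    inner ℝ (rankOne x y z) (rankOne x' y' z') =
      inner ℝ x x' * inner ℝ y y' * inner ℝ z z' := by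
  simp only [rankOne, PiLp.inner_apply, RCLike.inner_apply, conj_trivial, Fintype.sum_prod_type]
  rw [Finset.sum_mul_sum, Finset.sum_mul]
  refine Finset.sum_congr rfl fun a _ => ?_
  rw [Finset.sum_mul]
  refine Finset.sum_congr rfl fun b _ => ?_
  rw [Finset.mul_sum]
  exact Finset.sum_congr rfl fun c _ => by ring

lemma starProjection_span_eq {E : Type*} [NormedAddCommGroup E] [InnerProductSpace ℝ E]
    {S : Set E} [(Submodule.span ℝ S).HasOrthogonalProjection] {t v : E}
    (hv : v ∈ Submodule.span ℝ S) (h : ∀ s ∈ S, inner ℝ t s = inner ℝ v s) :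
    (Submodule.span ℝ S).starProjection t = v := by
  refine Submodule.eq_starProjection_of_mem_of_inner_eq_zero hv fun s hs => ?_
  induction hs using Submodule.span_induction with
  | mem s hs => rw [inner_sub_left, h s hs, sub_self]
  | zero => simp
  | add s s' _ _ h1 h2 => rw [inner_add_right, h1, h2, add_zero]
  | smul c s _ h1 => rw [inner_smul_right, h1, mul_zero]

lemma projUV_apply {u : Fin r → EuclideanSpace ℝ (Fin n₁)} {v : Fin r → EuclideanSpace ℝ (Fin n₂)}
    (hu : Orthonormal ℝ u) (hv : Orthonormal ℝ v) (T : Tensor n₁ n₂ n₃) :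
    projUV n₃ u v T = ∑ i, rankOne (u i) (v i) (contractAB T (u i) (v i)) := by
  refine starProjection_span_eq
    (Submodule.sum_mem _ fun i _ => Submodule.subset_span ⟨i, _, rfl⟩) ?_
  rintro _ ⟨i, z, rfl⟩
  rw [inner_rankOne_eq_contractAB, sum_inner, Finset.sum_eq_single i]
  · simp [inner_rankOne_rankOne, hu.1, hv.1]
  · intro j _ hj
    simp [inner_rankOne_rankOne, hu.2 hj]
  · simp

lemma projUW_apply {u : Fin r → EuclideanSpace ℝ (Fin n₁)} {w : Fin r → EuclideanSpace ℝ (Fin n₃)}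
    (hu : Orthonormal ℝ u) (hw : Orthonormal ℝ w) (T : Tensor n₁ n₂ n₃) :
    projUW n₂ u w T = ∑ i, rankOne (u i) (contractAC T (u i) (w i)) (w i) := by
  refine starProjection_span_eq
    (Submodule.sum_mem _ fun i _ => Submodule.subset_span ⟨i, _, rfl⟩) ?_
  rintro _ ⟨i, y, rfl⟩
  rw [inner_rankOne_eq_contractAC, sum_inner, Finset.sum_eq_single i]
  · simp [inner_rankOne_rankOne, hu.1, hw.1]
  · intro j _ hj
    simp [inner_rankOne_rankOne, hu.2 hj]
  · simp

lemma projVW_apply {v : Fin r → EuclideanSpace ℝ (Fin n₂)} {w : Fin r → EuclideanSpace ℝ (Fin n₃)}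
    (hv : Orthonormal ℝ v) (hw : Orthonormal ℝ w) (T : Tensor n₁ n₂ n₃) :
    projVW n₁ v w T = ∑ i, rankOne (contractBC T (v i) (w i)) (v i) (w i) := by
  refine starProjection_span_eq
    (Submodule.sum_mem _ fun i _ => Submodule.subset_span ⟨i, _, rfl⟩) ?_
  rintro _ ⟨i, x, rfl⟩
  rw [inner_rankOne_eq_contractBC, sum_inner, Finset.sum_eq_single i]
  · simp [inner_rankOne_rankOne, hv.1, hw.1]
  · intro j _ hj
    simp [inner_rankOne_rankOne, hv.2 hj]
  · simp

lemma projUVW_apply {u : Fin r → EuclideanSpace ℝ (Fin n₁)}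
    {v : Fin r → EuclideanSpace ℝ (Fin n₂)} {w : Fin r → EuclideanSpace ℝ (Fin n₃)}
    (hu : Orthonormal ℝ u) (hv : Orthonormal ℝ v) (hw : Orthonormal ℝ w) (T : Tensor n₁ n₂ n₃) :
    projUVW u v w T =
      ∑ i, rankOne (u i) (v i) (inner ℝ (contractAB T (u i) (v i)) (w i) • w i) := by
  refine starProjection_span_eq (Submodule.sum_mem _ fun i _ => ?_) ?_
  · have : rankOne (u i) (v i) (inner ℝ (contractAB T (u i) (v i)) (w i) • w i) =
        inner ℝ (contractAB T (u i) (v i)) (w i) • rankOne (u i) (v i) (w i) := by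
      ext t
      simp only [rankOne, WithLp.ofLp_smul, Pi.smul_apply, smul_eq_mul]
      ring
    rw [this]
    exact Submodule.smul_mem _ _ (Submodule.subset_span ⟨i, rfl⟩)
  · rintro _ ⟨i, rfl⟩
    rw [inner_rankOne_eq_contractAB, sum_inner, Finset.sum_eq_single i]
    · simp [inner_rankOne_rankOne, inner_smul_left, hu.1, hv.1, hw.1]
    · intro j _ hj
      simp [inner_rankOne_rankOne, hu.2 hj]
    · simp

end Contractions

/-! ### Tail bounds for the contractions of the centred sample -/

section ContractionTail

lemma setBernoulli_norm_sq_sum_gt_le {E ι : Type*} [NormedAddCommGroup E] [InnerProductSpace ℝ E]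
    [Fintype ι] {p : unitInterval} (hp0 : 0 < (p : ℝ)) (x : ι → E) {τ K : ℝ} (hτ : 0 < τ)
    (hK : 0 < K) (hvar : (∑ t, ‖x t‖ ^ 2) / p ≤ τ / K)
    (hmax : ∀ t, (‖x t‖ / p) ^ 2 ≤ 16 * τ / K ^ 2) :
    setBernoulli (Set.univ : Set ι) p
        {Ω | τ < ‖∑ t, (1 - Ω.indicator (fun _ => 1 / (p : ℝ)) t) • x t‖ ^ 2} ≤
      ENNReal.ofReal (Real.exp (1 / 2 - K / 16)) := by
  have hs : 0 < √τ := Real.sqrt_pos.2 hτ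
  have hs2 : √τ ^ 2 = τ := Real.sq_sqrt hτ.le
  have hL : 0 < 4 * √τ / K := by positivity
  have hL2 : (4 * √τ / K) ^ 2 = 16 * τ / K ^ 2 := by rw [div_pow, mul_pow, hs2]; norm_num
  -- this value of `L` makes the variance term half as large as the gain from the threshold
  refine le_trans (measure_mono fun Ω hΩ => ?_) ((setBernoulli_norm_sum_ge_le hL hp0 x
    (fun t => abs_le_of_sq_le_sq' ((hmax t).trans_eq hL2.symm) hL.le |>.2) √τ).trans
    (ENNReal.ofReal_le_ofReal (Real.exp_le_exp.2 ?_)))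
  · exact Real.sqrt_le_iff.2 ⟨norm_nonneg _, (show τ < _ from hΩ).le⟩
  · rw [← div_div, hL2]
    have h1 : (∑ t, ‖x t‖ ^ 2) / p / (16 * τ / K ^ 2) ≤ τ / K / (16 * τ / K ^ 2) := by gcongr
    have h2 : τ / K / (16 * τ / K ^ 2) = K / 16 := by field_simp
    have h3 : √τ / (2 * (4 * √τ / K)) = K / 8 := by field_simp; norm_num
    rw [h3]
    linarith

variable {n₁ n₂ n₃ r : ℕ}

lemma Incoherent.pos_and_one_le {n : ℕ} {μ : ℝ} {x : EuclideanSpace ℝ (Fin n)}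
    (h : Incoherent μ x) (hx : ‖x‖ = 1) : 0 < n ∧ 1 ≤ μ := by
  have h1 : (1 : ℝ) ≤ n * (μ / n) := by
    calc (1 : ℝ) = ∑ j, x j ^ 2 := by rw [← EuclideanSpace.real_norm_sq_eq, hx, one_pow]
      _ ≤ ∑ _j : Fin n, μ / n := Finset.sum_le_sum fun j _ => by simpa [hx] using h j
      _ = _ := by simp
  have hn : 0 < n := by
    rcases Nat.eq_zero_or_pos n with rfl | h0
    · norm_num at h1
    · exact h0
  refine ⟨hn, ?_⟩
  rwa [mul_div_cancel₀ _ (by positivity)] at h1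

lemma Incoherent.mul_sq_le {n n' : ℕ} {μ : ℝ} {x : EuclideanSpace ℝ (Fin n)}
    {y : EuclideanSpace ℝ (Fin n')} (hx : Incoherent μ x) (hy : Incoherent μ y)
    (hx1 : ‖x‖ = 1) (hy1 : ‖y‖ = 1) (j : Fin n) (k : Fin n') :
    (x j * y k) ^ 2 ≤ μ ^ 2 / (n * n') := by
  have h1 : x j ^ 2 ≤ μ / n := by simpa [hx1] using hx j
  have h2 : y k ^ 2 ≤ μ / n' := by simpa [hy1] using hy k
  calc (x j * y k) ^ 2 = x j ^ 2 * y k ^ 2 := by ring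
    _ ≤ μ / n * (μ / n') := mul_le_mul h1 h2 (sq_nonneg _) ((sq_nonneg _).trans h1)
    _ = _ := by ring

lemma restrictBar_apply (m : ℝ) (Ω : Set (Fin n₁ × Fin n₂ × Fin n₃)) (A : Tensor n₁ n₂ n₃)
    {p : ℝ} (hp : p = m / ((n₁ : ℝ) * n₂ * n₃)) (t : Fin n₁ × Fin n₂ × Fin n₃) :
    restrictBar m Ω A t = (1 - Ω.indicator (fun _ => 1 / p) t) * A t := by
  by_cases h : t ∈ Ω <;> simp [restrictBar, restrict, h, hp, sub_mul]

section AsSum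

variable (m : ℝ) (Ω : Set (Fin n₁ × Fin n₂ × Fin n₃)) (A : Tensor n₁ n₂ n₃) {p : ℝ}

lemma contractBC_restrictBar (hp : p = m / ((n₁ : ℝ) * n₂ * n₃)) (y : EuclideanSpace ℝ (Fin n₂))
    (z : EuclideanSpace ℝ (Fin n₃)) :
    contractBC (restrictBar m Ω A) y z = ∑ t, (1 - Ω.indicator (fun _ => 1 / p) t) •
      EuclideanSpace.single t.1 (A t * (y t.2.1 * z t.2.2)) := by
  ext a
  simp only [contractBC, restrictBar_apply m Ω A hp, WithLp.ofLp_sum, Finset.sum_apply,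
    WithLp.ofLp_smul, Pi.smul_apply, smul_eq_mul, Fintype.sum_prod_type, PiLp.single_apply, mul_ite,
    mul_zero]
  rw [Finset.sum_eq_single a (fun a' _ h => by simp [h.symm]) (by simp)]
  simp only [if_true, mul_assoc]

lemma contractAC_restrictBar (hp : p = m / ((n₁ : ℝ) * n₂ * n₃)) (x : EuclideanSpace ℝ (Fin n₁))
    (z : EuclideanSpace ℝ (Fin n₃)) :
    contractAC (restrictBar m Ω A) x z = ∑ t, (1 - Ω.indicator (fun _ => 1 / p) t) •
      EuclideanSpace.single t.2.1 (A t * (x t.1 * z t.2.2)) := by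
  ext b
  simp only [contractAC, restrictBar_apply m Ω A hp, WithLp.ofLp_sum, Finset.sum_apply,
    WithLp.ofLp_smul, Pi.smul_apply, smul_eq_mul, Fintype.sum_prod_type, PiLp.single_apply, mul_ite,
    mul_zero]
  refine Finset.sum_congr rfl fun a _ => ?_
  rw [Finset.sum_eq_single (s := Finset.univ) b (fun b' _ h => by simp [h.symm]) (by simp)]
  simp only [if_true, mul_assoc]

lemma contractAB_restrictBar (hp : p = m / ((n₁ : ℝ) * n₂ * n₃)) (x : EuclideanSpace ℝ (Fin n₁))
    (y : EuclideanSpace ℝ (Fin n₂)) :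
    contractAB (restrictBar m Ω A) x y = ∑ t, (1 - Ω.indicator (fun _ => 1 / p) t) •
      EuclideanSpace.single t.2.2 (A t * (x t.1 * y t.2.1)) := by
  ext c
  simp only [contractAB, restrictBar_apply m Ω A hp, WithLp.ofLp_sum, Finset.sum_apply,
    WithLp.ofLp_smul, Pi.smul_apply, smul_eq_mul, Fintype.sum_prod_type, PiLp.single_apply, mul_ite,
    mul_zero]
  refine Finset.sum_congr rfl fun a _ => Finset.sum_congr rfl fun b _ => ?_
  rw [Finset.sum_eq_single (s := Finset.univ) c (fun c' _ h => by simp [h.symm]) (by simp)]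
  simp only [mul_assoc, if_true]

end AsSum

lemma Bounded.sum_sq_le {B μ : ℝ} {A : Tensor n₁ n₂ n₃} (hA : Bounded B r μ A)
    (hN : 0 < (n₁ : ℝ) * n₂ * n₃) :
    ∑ t, A t ^ 2 ≤ (n₁ : ℝ) * n₂ * n₃ * (B / μ ^ 3) := by
  have h := hA.avg_abc
  rw [one_div, inv_mul_le_iff₀ hN] at h
  simpa only [Fintype.sum_prod_type] using h

/-- The tail bound for one contraction. The weights `g` are products of two entries of incoherent
unit vectors, and `κ` selects the index that is not contracted, of size `d`. -/
lemma setBernoulli_contraction_gt_le {B μ m C K nm : ℝ} {A : Tensor n₁ n₂ n₃}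
    (hA : Bounded B r μ A) (hB : 0 < B) (hr : 1 ≤ r) (hN : 0 < (n₁ : ℝ) * n₂ * n₃)
    (hμ : 1 ≤ μ) (hC : 1 ≤ C) (hK : 0 < K) (hμnm : μ ≤ nm)
    {p : unitInterval} (hp : (p : ℝ) = m / ((n₁ : ℝ) * n₂ * n₃))
    (hm : C * K * nm * r * μ ^ 2 ≤ m)
    {d : ℕ} (hd : (d : ℝ) ≤ nm) (κ : Fin n₁ × Fin n₂ × Fin n₃ → Fin d)
    (g : Fin n₁ × Fin n₂ × Fin n₃ → ℝ)
    (hg : ∀ t, g t ^ 2 ≤ μ ^ 2 * d / ((n₁ : ℝ) * n₂ * n₃)) :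
    setBernoulli (Set.univ : Set (Fin n₁ × Fin n₂ × Fin n₃)) p
        {Ω | B * ((n₁ : ℝ) * n₂ * n₃) / (C * r * μ ^ 3) <
          ‖∑ t, (1 - Ω.indicator (fun _ => 1 / (p : ℝ)) t) •
            EuclideanSpace.single (κ t) (A t * g t)‖ ^ 2} ≤
      ENNReal.ofReal (Real.exp (1 / 2 - K / 16)) := by
  have hμ0 : 0 < μ := by linarith
  have hC0 : 0 < C := by linarith
  have hr0 : (0 : ℝ) < r := by exact_mod_cast hr
  have hnm : 0 < nm := hμ0.trans_le hμnm
  have hd0 : (0 : ℝ) ≤ d := d.cast_nonneg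
  have hsum := hA.sum_sq_le hN
  have hm0 : 0 < m := lt_of_lt_of_le (by positivity) hm
  set N := (n₁ : ℝ) * n₂ * n₃
  have hp0 : 0 < (p : ℝ) := by rw [hp]; positivity
  have hnorm : ∀ t, ‖EuclideanSpace.single (κ t) (A t * g t)‖ ^ 2 = A t ^ 2 * g t ^ 2 := by
    intro t
    rw [PiLp.norm_single, Real.norm_eq_abs, sq_abs, mul_pow]
  refine setBernoulli_norm_sq_sum_gt_le hp0 _ (by positivity) hK ?_ fun t => ?_
  · simp_rw [hnorm]
    have hle : ∑ t, A t ^ 2 * g t ^ 2 ≤ B * d / μ := by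
      calc _ ≤ ∑ t, A t ^ 2 * (μ ^ 2 * d / N) := by gcongr with t; exact hg t
        _ = (∑ t, A t ^ 2) * (μ ^ 2 * d / N) := by rw [Finset.sum_mul]
        _ ≤ N * (B / μ ^ 3) * (μ ^ 2 * d / N) := by gcongr
        _ = _ := by field_simp
    have hmd : C * K * d * r * μ ^ 2 ≤ m := le_trans (by gcongr) hm
    calc _ ≤ B * d / μ / p := by gcongr
      _ = B * N * d / (μ * m) := by rw [hp]; field_simp
      _ ≤ _ := by
        rw [div_div, div_le_div_iff₀ (by positivity) (by positivity)]
        calc B * N * d * (C * r * μ ^ 3 * K) = B * N * μ * (C * K * d * r * μ ^ 2) := by ring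
          _ ≤ B * N * μ * m := by gcongr
          _ = _ := by ring
  · rw [div_pow, hnorm]
    have hmd : C * r ^ 2 * μ ^ 5 * K ^ 2 * d ≤ m ^ 2 := by
      calc C * r ^ 2 * μ ^ 5 * K ^ 2 * d
          = C * 1 * (r ^ 2 * μ ^ 4 * K ^ 2) * (μ * d) := by ring
        _ ≤ C * C * (r ^ 2 * μ ^ 4 * K ^ 2) * (nm * nm) := by gcongr
        _ = (C * K * nm * r * μ ^ 2) ^ 2 := by ring
        _ ≤ m ^ 2 := by gcongr
    have hent : A t ^ 2 ≤ B * r := hA.entry t.1 t.2.1 t.2.2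
    calc _ ≤ B * r * (μ ^ 2 * d / N) / (p : ℝ) ^ 2 := by gcongr; exact hg t
      _ = B * N * (r * μ ^ 2 * d) / m ^ 2 := by rw [hp]; field_simp
      _ ≤ 16 * B * N * (r * μ ^ 2 * d) / m ^ 2 := by
        gcongr
        nlinarith
      _ ≤ _ := by
        rw [← mul_div_assoc, div_div, div_le_div_iff₀ (by positivity) (by positivity)]
        calc 16 * B * N * (r * μ ^ 2 * d) * (C * r * μ ^ 3 * K ^ 2)
            = 16 * (B * N) * (C * r ^ 2 * μ ^ 5 * K ^ 2 * d) := by ring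
          _ ≤ 16 * (B * N) * m ^ 2 := by gcongr

/-- The failure probability of one contraction, multiplied by the number of contractions. -/
lemma mul_exp_lt_four_mul_rpow {nm : ℕ} (hnm : 2 ≤ nm) (hr : r ≤ nm) {β : ℝ} (hβ : 0 < β) :
    r * Real.exp (1 / 2 - 10000 * (2 + β) ^ 2 * Real.log nm / 16) <
      4 * (nm : ℝ) ^ (-(β + 1)) := by
  have hnm0 : (0 : ℝ) < nm := by positivity
  have hlog : 0 < Real.log nm := Real.log_pos (by exact_mod_cast hnm)
  -- `10000 / 16 = 625` leaves ample room: `exp (-(2 + β) * log nm)` would be enough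
  rw [Real.rpow_def_of_pos hnm0]
  have he : Real.exp (1 / 2) < 4 :=
    (Real.exp_le_exp.2 (by norm_num)).trans_lt (Real.exp_one_lt_d9.trans (by norm_num))
  calc _ ≤ Real.exp (Real.log nm) *
        Real.exp (1 / 2 - 10000 * (2 + β) ^ 2 * Real.log nm / 16) := by
        rw [Real.exp_log hnm0]; gcongr
    _ ≤ Real.exp (1 / 2) * Real.exp (Real.log nm * -(β + 1)) := by
        rw [← Real.exp_add, ← Real.exp_add]
        refine Real.exp_le_exp.2 ?_
        nlinarith [mul_pos hβ hlog, mul_pos (mul_pos hβ hβ) hlog]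
    _ < _ := by gcongr

/-- The union bound over the `r` contractions. -/
lemma setBernoulli_exists_contraction_gt_lt {B μ m C β : ℝ} {nm : ℕ} {A : Tensor n₁ n₂ n₃}
    (hA : Bounded B r μ A) (hB : 0 < B) (hr : 1 ≤ r) (hN : 0 < (n₁ : ℝ) * n₂ * n₃)
    (hμ : 1 ≤ μ) (hC : 1 ≤ C) (hβ : 0 < β) (hnm : 2 ≤ nm) (hμr : μ * r ≤ nm)
    {p : unitInterval} (hp : (p : ℝ) = m / ((n₁ : ℝ) * n₂ * n₃))
    (hm : m > 10000 * C * (2 + β) ^ 2 * nm * r * μ ^ 2 * Real.log nm)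
    {d : ℕ} (hd : d ≤ nm) (κ : Fin n₁ × Fin n₂ × Fin n₃ → Fin d)
    (g : Fin r → Fin n₁ × Fin n₂ × Fin n₃ → ℝ)
    (hg : ∀ i t, g i t ^ 2 ≤ μ ^ 2 * d / ((n₁ : ℝ) * n₂ * n₃)) :
    setBernoulli (Set.univ : Set (Fin n₁ × Fin n₂ × Fin n₃)) p
        {Ω | ∃ i, B * ((n₁ : ℝ) * n₂ * n₃) / (C * r * μ ^ 3) <
          ‖∑ t, (1 - Ω.indicator (fun _ => 1 / (p : ℝ)) t) •
            EuclideanSpace.single (κ t) (A t * g i t)‖ ^ 2} <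
      ENNReal.ofReal (4 * (nm : ℝ) ^ (-(β + 1))) := by
  have hlog : 0 < Real.log nm := Real.log_pos (by exact_mod_cast hnm)
  have hr1 : (1 : ℝ) ≤ r := by exact_mod_cast hr
  have hμnm : μ ≤ nm := by nlinarith
  have hrnm : r ≤ nm := by
    have : (r : ℝ) ≤ nm := by nlinarith
    exact_mod_cast this
  have hm' : C * (10000 * (2 + β) ^ 2 * Real.log nm) * nm * r * μ ^ 2 ≤ m := by linarith
  rw [Set.ofPred_exists]
  refine (measure_iUnion_fintype_le _ _).trans_lt ?_
  refine (Finset.sum_le_sum fun i _ => setBernoulli_contraction_gt_le hA hB hr hN hμ hC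
    (by positivity) hμnm hp hm' (Nat.cast_le.2 hd) κ (g i) (hg i)).trans_lt ?_
  rw [Finset.sum_const, Finset.card_univ, Fintype.card_fin, nsmul_eq_mul,
    ← ENNReal.ofReal_natCast, ← ENNReal.ofReal_mul (Nat.cast_nonneg r)]
  exact (ENNReal.ofReal_lt_ofReal_iff (by positivity)).2 (mul_exp_lt_four_mul_rpow hnm hrnm hβ)

end ContractionTail

end TensorCompletion

theorem mainTheorem9 {n₁ n₂ n₃ r : ℕ} (hr : 1 ≤ r)
    (u : Fin r → EuclideanSpace ℝ (Fin n₁)) (v : Fin r → EuclideanSpace ℝ (Fin n₂))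
    (w : Fin r → EuclideanSpace ℝ (Fin n₃))
    (hu : Orthonormal ℝ u) (hv : Orthonormal ℝ v) (hw : Orthonormal ℝ w)
    (μ : ℝ)
    (hu_inc : ∀ i, TensorCompletion.Incoherent μ (u i))
    (hv_inc : ∀ i, TensorCompletion.Incoherent μ (v i))
    (hw_inc : ∀ i, TensorCompletion.Incoherent μ (w i))
    (A : TensorCompletion.Tensor n₁ n₂ n₃) (B : ℝ) (hA : TensorCompletion.Bounded B r μ A)
    (C β m : ℝ) (hC : 1 ≤ C) (hβ : 0 < β)
    (nmax : ℕ) (hnmax : nmax = max n₁ (max n₂ n₃))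
    (p : unitInterval) (hp : (p : ℝ) = m / ((n₁ : ℝ) * n₂ * n₃))
    (hm1 : m > 10000 * C * (2 + β) ^ 2 * nmax * r * μ ^ 2 * Real.log nmax)
    (hm2 : m > 10000 * C * (2 + β) ^ 2 * r * Real.sqrt n₁ * (max n₂ n₃ : ℕ) * μ ^ (3 / 2 : ℝ) *
      Real.log nmax)
    (hμr : μ * r ≤ (min n₁ (min n₂ n₃) : ℕ)) :
    ∀ P' ∈ ({TensorCompletion.projUV n₃ u v, TensorCompletion.projUW n₂ u w,
        TensorCompletion.projVW n₁ v w, TensorCompletion.projUVW u v w} :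
        Set (TensorCompletion.Tensor n₁ n₂ n₃ →L[ℝ] TensorCompletion.Tensor n₁ n₂ n₃)),
      ProbabilityTheory.setBernoulli (Set.univ : Set (Fin n₁ × Fin n₂ × Fin n₃)) p
        {Ω | TensorCompletion.specNorm (TensorCompletion.tensorTranspose
              (P' (TensorCompletion.restrictBar m Ω A))) >
            B * ((n₁ : ℝ) * n₂ * n₃) / (C * r * μ ^ 3)} <
        ENNReal.ofReal (4 * (nmax : ℝ) ^ (-(β + 1))) := by
  open TensorCompletion in
  intro P' hP'
  obtain ⟨hn1, hμ⟩ := (hu_inc ⟨0, hr⟩).pos_and_one_le (hu.1 _)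
  have hn2 := ((hv_inc ⟨0, hr⟩).pos_and_one_le (hv.1 _)).1
  have hn3 := ((hw_inc ⟨0, hr⟩).pos_and_one_le (hw.1 _)).1
  have hN : 0 < (n₁ : ℝ) * n₂ * n₃ := by positivity
  have hμ0 : 0 < μ := by linarith
  have hr0 : (0 : ℝ) < r := by exact_mod_cast hr
  have hd1 : n₁ ≤ nmax := by omega
  have hd2 : n₂ ≤ nmax := by omega
  have hd3 : n₃ ≤ nmax := by omega
  rcases (show 1 ≤ nmax by omega).eq_or_lt with h1 | h2
  · -- in dimension one the claimed bound exceeds `1`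
    refine lt_of_le_of_lt prob_le_one ?_
    rw [← h1, ← ENNReal.ofReal_one, Nat.cast_one, Real.one_rpow]
    exact (ENNReal.ofReal_lt_ofReal_iff (by norm_num)).2 (by norm_num)
  have hnm0 : (0 : ℝ) < nmax := by positivity
  have hB : 0 ≤ B := nonneg_of_mul_nonneg_left
    ((sq_nonneg _).trans (hA.entry ⟨0, hn1⟩ ⟨0, hn2⟩ ⟨0, hn3⟩)) hr0
  rcases hB.eq_or_lt with hB0 | hB0
  · -- if `B = 0` then `A = 0`, and the event is empty
    have hA0 : A = 0 := by
      ext t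
      have := hA.entry t.1 t.2.1 t.2.2
      rw [← hB0, zero_mul] at this
      exact pow_eq_zero_iff two_ne_zero |>.1 (le_antisymm this (sq_nonneg _))
    have h0 : tensorTranspose (0 : Tensor n₁ n₂ n₃) = 0 := by
      ext
      simp [tensorTranspose, slice, Matrix.sum_apply]
    simp only [hA0, map_zero, h0, specNorm, ← hB0]
    simp only [norm_zero, zero_mul, zero_div, gt_iff_lt, lt_irrefl, Set.ofPred_false,
      measure_empty]
    exact ENNReal.ofReal_pos.2 (by positivity)
  have hμr' : μ * r ≤ nmax := hμr.trans (by exact_mod_cast (by omega))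
  set τ := B * ((n₁ : ℝ) * n₂ * n₃) / (C * r * μ ^ 3) with hτ
  have hτ0 : 0 ≤ τ := by positivity
  have tailAB : setBernoulli (Set.univ : Set (Fin n₁ × Fin n₂ × Fin n₃)) p
      {Ω | ∃ i, τ < ‖contractAB (restrictBar m Ω A) (u i) (v i)‖ ^ 2} <
        ENNReal.ofReal (4 * (nmax : ℝ) ^ (-(β + 1))) := by
    simp only [contractAB_restrictBar m _ A hp]
    refine setBernoulli_exists_contraction_gt_lt hA hB0 hr hN hμ hC hβ h2 hμr' hp hm1 hd3
      (fun t => t.2.2) (fun i t => u i t.1 * v i t.2.1) fun i t => ?_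
    refine ((hu_inc i).mul_sq_le (hv_inc i) (hu.1 i) (hv.1 i) _ _).trans_eq ?_
    field_simp
  have tailAC : setBernoulli (Set.univ : Set (Fin n₁ × Fin n₂ × Fin n₃)) p
      {Ω | ∃ i, τ < ‖contractAC (restrictBar m Ω A) (u i) (w i)‖ ^ 2} <
        ENNReal.ofReal (4 * (nmax : ℝ) ^ (-(β + 1))) := by
    simp only [contractAC_restrictBar m _ A hp]
    refine setBernoulli_exists_contraction_gt_lt hA hB0 hr hN hμ hC hβ h2 hμr' hp hm1 hd2
      (fun t => t.2.1) (fun i t => u i t.1 * w i t.2.2) fun i t => ?_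
    refine ((hu_inc i).mul_sq_le (hw_inc i) (hu.1 i) (hw.1 i) _ _).trans_eq ?_
    field_simp
  have tailBC : setBernoulli (Set.univ : Set (Fin n₁ × Fin n₂ × Fin n₃)) p
      {Ω | ∃ i, τ < ‖contractBC (restrictBar m Ω A) (v i) (w i)‖ ^ 2} <
        ENNReal.ofReal (4 * (nmax : ℝ) ^ (-(β + 1))) := by
    simp only [contractBC_restrictBar m _ A hp]
    refine setBernoulli_exists_contraction_gt_lt hA hB0 hr hN hμ hC hβ h2 hμr' hp hm1 hd1
      (fun t => t.1) (fun i t => v i t.2.1 * w i t.2.2) fun i t => ?_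
    refine ((hv_inc i).mul_sq_le (hw_inc i) (hv.1 i) (hw.1 i) _ _).trans_eq ?_
    field_simp
  simp only [Set.mem_insert_iff, Set.mem_singleton_iff] at hP'
  rcases hP' with rfl | rfl | rfl | rfl
  · refine (measure_mono fun Ω hΩ => ?_).trans_lt tailAB
    rw [Set.mem_ofPred_eq] at hΩ ⊢
    by_contra! hcon
    refine hΩ.not_ge ?_
    rw [projUV_apply hu hv]
    refine specNorm_tensorTranspose_le_of_orthonormal_fst hu _ _
      (fun k l hkl => by simp only [hv.2 hkl, zero_mul]) hτ0 fun k => ?_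
    rw [hv.1, one_mul]
    exact hcon k
  · refine (measure_mono fun Ω hΩ => ?_).trans_lt tailAC
    rw [Set.mem_ofPred_eq] at hΩ ⊢
    by_contra! hcon
    refine hΩ.not_ge ?_
    rw [projUW_apply hu hw]
    refine specNorm_tensorTranspose_le_of_orthonormal_fst hu _ _
      (fun k l hkl => by simp only [hw.2 hkl, mul_zero]) hτ0 fun k => ?_
    rw [hw.1, mul_one]
    exact hcon k
  · refine (measure_mono fun Ω hΩ => ?_).trans_lt tailBC
    rw [Set.mem_ofPred_eq] at hΩ ⊢
    by_contra! hcon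
    refine hΩ.not_ge ?_
    rw [projVW_apply hv hw]
    exact specNorm_tensorTranspose_le_of_orthonormal_snd_trd _ hv hw hτ0 hcon
  · refine (measure_mono fun Ω hΩ => ?_).trans_lt tailAB
    rw [Set.mem_ofPred_eq] at hΩ ⊢
    by_contra! hcon
    refine hΩ.not_ge ?_
    rw [projUVW_apply hu hv hw]
    refine specNorm_tensorTranspose_le_of_orthonormal_fst hu _ _
      (fun k l hkl => by simp only [hv.2 hkl, zero_mul]) hτ0 fun k => ?_
    -- Cauchy–Schwarz: contracting the third index with a unit vector does not increase the norm
    rw [hv.1, one_mul, norm_smul, hw.1, mul_one]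
    refine le_trans (pow_le_pow_left₀ (norm_nonneg _) ?_ 2) (hcon k)
    simpa [hw.1] using abs_real_inner_le_norm (contractAB (restrictBar m Ω A) (u k) (v k)) (w k)
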